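/- Let $N\ge 2$, let $\Omega\subset\mathbb R^N$ be a bounded domain with $C^{1,1}$ boundary, let $p>1$ and $s\in(0,1)$ with $ps<N$, and put $p^*_s=\frac{Np}{N-ps}$. Let $W^{s,p}_0(\Omega)$ be the space of all $u\in L^p(\mathbb R^N)$ with $u=0$ a.e. in $\mathbb R^N\setminus\Omega$ and $$\|u\|_{W^{s,p}_0(\Omega)}=\Big[\iint_{\mathbb R^N\times\mathbb R^N}\frac{|u(x)-u(y)|^p}{|x-y|^{N+ps}}\,dx\,dy\Big]^{1/p}<\infty ,$$ and let $\|\cdot\|_r$ denote the norm of $L^r(\Omega)$. For $q\in[1,p^*_s]$ and $C_0>0$ we say that $f:\Omega\times\mathbb R\to\mathbb R$ satisfies $\mathbf H_q$ (with constant $C_0$) if $f$ is a Carathéodory function and $|f(x,t)|\le C_0(1+|t|^{q-1})$ for a.e. $x\in\Omega$ and all $t\in\mathbb R$. A (weak) solution of the problem $$(-\Delta)_p^s u=f(x,u)\ \text{ in }\Omega,\qquad u=0\ \text{ in }\mathbb R^N\setminus\Omega \tag{1}$$ is a function $u\in W^{s,p}_0(\Omega)$ such that for all $\varphi\in W^{s,p}_0(\Omega)$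 $$\iint_{\mathbb R^N\times\mathbb R^N}\frac{|u(x)-u(y)|^{p-2}(u(x)-u(y))(\varphi(x)-\varphi(y))}{|x-y|^{N+ps}}\,dx\,dy=\int_\Omega f(x,u)\varphi\,dx .$$ **Proposition.** Let $f$ satisfy $\mathbf H_q$ with constant $C_0$ for some $q\in[1,p^*_s]$, and let $u\in W^{s,p}_0(\Omega)$ be a solution of (1). Then $u\in L^\infty(\Omega)$. Moreover: 1. if $q=p^*_s$, then there exists $\varepsilon_0>0$, depending only on $\Omega,p,s,C_0$, such that for all $K>0$ satisfying $$\int_{\{x\in\Omega:\,|u(x)|\ge K\}}|u|^{p^*_s}\,dx\le\varepsilon_0$$ we have $\|u\|_\infty\le C$, for a constant $C>0$ depending only on $\Omega,p,s,C_0$, $K$ and an upper bound for $\|u\|_{p^*_s}$; 2. if $1\le q<p^*_s$, then $\|u\|_\infty\le C$, for a constant $C>0$ depending only on $\Omega,p,q,s,C_0$ and an upper bound for $\|u\|_{p^*_s}$; 3. if $1\le q<p$, then $\|u\|_{W^{s,p}_0(\Omega)}\le C$ and $\|u\|_\infty\le C$, for a constant $C>0$ depending only on $\Omega,p,q,s,C_0$.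 -/

import Mathlib

open MeasureTheory
open scoped ENNReal NNReal

noncomputable section

namespace FracPLap

/-- The Euclidean space of dimension `N`. -/
abbrev Space (N : ℕ) : Type := EuclideanSpace ℝ (Fin N)

/-- A bounded domain (nonempty, open, connected) whose boundary is of class `C^{1,1}`: near each
boundary point, in suitable orthonormal coordinates with last axis `e`, the set `Ω` is the region
strictly above the graph of a differentiable function `γ`, with Lipschitz continuous derivative,
of the component of `x` orthogonal to `e`. -/
structure IsBoundedC11Domain {N : ℕ} (Ω : Set (Space N)) : Prop where
  isOpen : IsOpen Ω
  isConnected : IsConnected Ω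
  isBounded : Bornology.IsBounded Ω
  boundary : ∀ x₀ ∈ frontier Ω, ∃ r : ℝ, 0 < r ∧ ∃ e : Space N, ‖e‖ = 1 ∧
    ∃ γ : Space N → ℝ, Differentiable ℝ γ ∧ (∃ L : ℝ≥0, LipschitzWith L (fderiv ℝ γ)) ∧
      ∀ x ∈ Metric.ball x₀ r, (x ∈ Ω ↔ γ (x - (inner ℝ e x : ℝ) • e) < (inner ℝ e x : ℝ))

/-- The Gagliardo seminorm `[u]_{s,p}` on the whole space, with values in `[0, ∞]`. -/
def gagliardo {N : ℕ} (s p : ℝ) (u : Space N → ℝ) : ℝ≥0∞ :=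
  (∫⁻ z : Space N × Space N,
    ENNReal.ofReal (|u z.1 - u z.2| ^ p / ‖z.1 - z.2‖ ^ ((N : ℝ) + p * s))) ^ (1 / p)

/-- `u` (a representative of) an element of `W^{s,p}_0(Ω)`: `u` is in `L^p` of the whole space, has
finite Gagliardo seminorm, and vanishes almost everywhere outside `Ω`. The norm of `W^{s,p}_0(Ω)`
is `gagliardo s p u`. -/
structure MemW0 {N : ℕ} (s p : ℝ) (Ω : Set (Space N)) (u : Space N → ℝ) : Prop where
  memLp : MemLp u (ENNReal.ofReal p) volume
  gagliardo_lt_top : gagliardo s p u < ∞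
  ae_eq_zero : ∀ᵐ x ∂(volume.restrict Ωᶜ), u x = 0

/-- The duality pairing `⟨(-Δ)_p^s u, φ⟩`. -/
def pairing {N : ℕ} (s p : ℝ) (u φ : Space N → ℝ) : ℝ :=
  ∫ z : Space N × Space N,
    |u z.1 - u z.2| ^ (p - 2) * (u z.1 - u z.2) * (φ z.1 - φ z.2)
      / ‖z.1 - z.2‖ ^ ((N : ℝ) + p * s)

/-- The fractional critical Sobolev exponent `p_s^* = N p / (N - p s)`. -/
def critExp (N : ℕ) (s p : ℝ) : ℝ := (N : ℝ) * p / ((N : ℝ) - p * s)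

/-- The structural hypothesis on the reaction, with growth exponent `q` and constant `C₀`:
`f` is a Carathéodory function on `Ω × ℝ` (Lebesgue measurable in `x` for every `t`, continuous in
`t` for a.e. `x`) and `|f(x,t)| ≤ C₀ (1 + |t|^{q-1})`. Only the values `f x t` with `x ∈ Ω`
matter. -/
structure GrowthCondition {N : ℕ} (Ω : Set (Space N)) (q C₀ : ℝ) (f : Space N → ℝ → ℝ) :
    Prop where
  aemeasurable : ∀ t : ℝ, AEMeasurable (fun x => f x t) (volume.restrict Ω)
  continuous : ∀ᵐ x ∂(volume.restrict Ω), Continuous (f x)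
  growth : ∀ᵐ x ∂(volume.restrict Ω), ∀ t : ℝ, |f x t| ≤ C₀ * (1 + |t| ^ (q - 1))

/-- `u` is a weak solution of `(-Δ)_p^s u = f(x,u)` in `Ω`, `u = 0` outside `Ω`. -/
structure IsWeakSolution {N : ℕ} (s p : ℝ) (Ω : Set (Space N)) (f : Space N → ℝ → ℝ)
    (u : Space N → ℝ) : Prop where
  memW0 : MemW0 s p Ω u
  weak : ∀ φ : Space N → ℝ, MemW0 s p Ω φ → pairing s p u φ = ∫ x in Ω, f x (u x) * φ x

/-- The norm of `u` in `L^r(Ω)`, `r ∈ [0, ∞]`, with values in `[0, ∞]`. -/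
def normOn {N : ℕ} (Ω : Set (Space N)) (r : ℝ≥0∞) (u : Space N → ℝ) : ℝ≥0∞ :=
  eLpNorm u r (volume.restrict Ω)

end FracPLap

end

/-!
The bounds come from a De Giorgi iteration that is invariant under the scaling of the critical
exponent `P = critExp N s p`.

For `k > 0`, test the equation with `(u - k)₊`. Since truncation is monotone and `1`-Lipschitz,
the pairing dominates the energy of `(u - k)₊` (`MemW0.gagliardo_comp_rpow_le`), and the
fractional Sobolev inequality (`exists_sobolev`) bounds `(∫ (u - k)₊ ^ P) ^ (p / P)` by
a multiple of `∫_{u > k} u ^ (P - 1) * (u - k)`. For `h < k` one has `u ≤ k / (k - h) * (u - h)`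
on `{u > k}`, so this is at most `(k / (k - h)) ^ (P - 1) * ∫ (u - h)₊ ^ P` (`levelset_step`).
Along the levels `k₀ * (2 - 2 ^ (-n))` the factors `k / (k - h)` depend on `n` only, and since
`p / P < 1` the recursion is superlinear. Hence `u ≤ 2 * k₀` as soon as `∫_{u ≥ k₀} u ^ P` is small
relative to the constant in front (`exists_smallness_ae_le`). If the growth exponent of the
reaction is `q ≤ P`, that constant above the level `k₀ ≥ 1` is `C₀ * k₀ ^ (q - P)` up to a factor
depending on `N, s, p`.

At `q = P` the smallness is a universal threshold for the integral
(`exists_critical_threshold`), and it is reached at some level because `u ∈ L^P`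
(`exists_abs_ae_le`). At `q < P` a bound on the `L^P` norm suffices, as `k₀ ^ (q - P) → 0`
(`exists_bound_of_subcritical`). At `q < p`, testing with `u` itself bounds the energy, hence
the `L^P` norm (`exists_gagliardo_bound`).

The Sobolev inequality is proved by a pointwise estimate (`exists_rpow_critExp_le`): for `v ≥ 0`,
`v(x) ^ P ≤ C * (∫ v ^ P) ^ (p * s / N) * ∫ |v(x) - v(y)| ^ p / |x - y| ^ (N + p * s) dy`.
Integrating in `x` and dividing by the power of `∫ v ^ P`, which is finite for bounded `v`, gives
the inequality.
-/

open MeasureTheory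
open scoped ENNReal NNReal

namespace FracPLap

variable {N : ℕ} {s p : ℝ} {Ω : Set (Space N)} {u φ : Space N → ℝ} {T : ℝ → ℝ}

/-! ### The fractional Sobolev inequality -/

lemma critExp_gt (hp : 0 < p) (hs : 0 < s) (hps : p * s < N) : p < critExp N s p := by
  unfold critExp
  have : 0 < p * s := mul_pos hp hs
  rw [lt_div_iff₀ (by linarith)]
  nlinarith

lemma critExp_identity (hp : 0 < p) (hs : 0 < s) (hps : p * s < N) :
    p + critExp N s p * (p * s / N) = critExp N s p := by
  unfold critExp
  have h0 : 0 < p * s := mul_pos hp hs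
  have h1 : (0 : ℝ) < N - p * s := by linarith
  have h2 : (0 : ℝ) < N := by linarith
  field_simp
  ring

/-- The pointwise estimate behind the fractional Sobolev inequality. If `v x = t > 0`, then by
Markov's inequality `v < t / 2` on at least half of a ball around `x` whose volume is
comparable with `t ^ (-p*) * ∫ v ^ p*`, and there `|v x - v y| ≥ t / 2`. -/
lemma exists_rpow_critExp_le (hp : 0 < p) (hs : 0 < s) (hps : p * s < N) :
    ∃ C : ℝ, 0 < C ∧ ∀ v : Space N → ℝ, Measurable v → (∀ x, 0 ≤ v x) →
      ∀ I : ℝ, 0 < I → ∫⁻ x, ENNReal.ofReal (v x ^ critExp N s p) ≤ ENNReal.ofReal I →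
      ∀ x, ENNReal.ofReal (v x ^ critExp N s p) ≤ ENNReal.ofReal (C * I ^ (p * s / N)) *
        ∫⁻ y, ENNReal.ofReal (|v x - v y| ^ p / ‖x - y‖ ^ ((N : ℝ) + p * s)) := by
  set P := critExp N s p with hP
  have hpP : p < P := critExp_gt hp hs hps
  have hid : p + P * (p * s / N) = P := critExp_identity hp hs hps
  have hP0 : 0 < P := hp.trans hpP
  have hps0 : 0 < p * s := mul_pos hp hs
  have hN0 : (0 : ℝ) < N := hps0.trans hps
  have hNne : N ≠ 0 := by rintro rfl; simp at hN0
  have : Nonempty (Fin N) := ⟨⟨0, Nat.pos_of_ne_zero hNne⟩⟩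
  set ω : ℝ := (volume (Metric.ball (0 : Space N) 1)).toReal with hω
  have hωpos : 0 < ω := ENNReal.toReal_pos
    (Metric.measure_ball_pos volume _ one_pos).ne' measure_ball_lt_top.ne
  have hωe : volume (Metric.ball (0 : Space N) 1) = ENNReal.ofReal ω :=
    (ENNReal.ofReal_toReal measure_ball_lt_top.ne).symm
  set a : ℝ := 2 ^ (P + 1) / ω with ha
  have ha0 : 0 < a := by positivity
  refine ⟨2 ^ (p + 1) / ω * a ^ (p * s / N), by positivity, ?_⟩
  intro v hv hv0 I hI hIv x
  rcases (hv0 x).eq_or_lt with h0 | ht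
  · rw [← h0, Real.zero_rpow hP0.ne']; simp
  set t := v x with ht'
  set b : ℝ := a * I / t ^ P with hb
  have hb0 : 0 < b := by positivity
  -- the radius for which the ball has volume `2 * I / (t / 2) ^ P`
  set r : ℝ := b ^ (1 / (N : ℝ)) with hr
  have hr0 : 0 < r := by positivity
  have hrN : r ^ N = b := by
    rw [hr, ← Real.rpow_natCast, ← Real.rpow_mul hb0.le, one_div_mul_cancel hN0.ne', Real.rpow_one]
  have hrps : r ^ (p * s) = b ^ (p * s / N) := by
    rw [hr, ← Real.rpow_mul hb0.le]; congr 1; ring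
  have hball : volume (Metric.ball x r) = ENNReal.ofReal (b * ω) := by
    rw [Measure.addHaar_ball volume x hr0.le, hωe, finrank_euclideanSpace, Fintype.card_fin, hrN,
      ENNReal.ofReal_mul hb0.le]
  have hmarkov : volume {y | t / 2 ≤ v y} ≤ ENNReal.ofReal (b * ω / 2) := by
    have hsub : {y | t / 2 ≤ v y} ⊆
        {y | ENNReal.ofReal ((t / 2) ^ P) ≤ ENNReal.ofReal (v y ^ P)} := by
      intro y hy
      exact ENNReal.ofReal_le_ofReal (Real.rpow_le_rpow (by positivity) hy hP0.le)
    have hpos : 0 < (t / 2) ^ P := by positivity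
    refine (measure_mono hsub).trans ((meas_ge_le_lintegral_div
      (by fun_prop) (ENNReal.ofReal_pos.2 hpos).ne' ENNReal.ofReal_ne_top).trans ?_)
    refine (ENNReal.div_le_div_right hIv _).trans ?_
    rw [← ENNReal.ofReal_div_of_pos hpos]
    apply le_of_eq
    congr 1
    rw [hb, ha, Real.div_rpow ht.le (by norm_num), Real.rpow_add (by norm_num), Real.rpow_one]
    have : (0 : ℝ) < 2 ^ P := by positivity
    have : (0 : ℝ) < t ^ P := by positivity
    field_simp
  set S : Set (Space N) := Metric.ball x r \ {y | t / 2 ≤ v y} with hS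
  have hSm : MeasurableSet S :=
    measurableSet_ball.diff (measurableSet_le measurable_const hv)
  have hSvol : ENNReal.ofReal (b * ω / 2) ≤ volume S := by
    refine le_trans ?_ (le_measure_sdiff)
    rw [hball]
    refine le_trans ?_ (tsub_le_tsub_left hmarkov _)
    rw [← ENNReal.ofReal_sub _ (by positivity)]
    apply le_of_eq; congr 1; ring
  have hG : ENNReal.ofReal ((t / 2) ^ p / r ^ ((N : ℝ) + p * s)) * ENNReal.ofReal (b * ω / 2) ≤
      ∫⁻ y, ENNReal.ofReal (|v x - v y| ^ p / ‖x - y‖ ^ ((N : ℝ) + p * s)) := by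
    refine le_trans (mul_le_mul_right hSvol _) ?_
    rw [← setLIntegral_const]
    refine le_trans (setLIntegral_mono' hSm ?_) (setLIntegral_le_lintegral S _)
    rintro y ⟨hy1, hy2⟩
    have hy2 : v y < t / 2 := not_le.1 hy2
    have hxy : 0 < ‖x - y‖ := by
      rw [norm_pos_iff, sub_ne_zero]
      rintro rfl
      linarith
    have hxyr : ‖x - y‖ ≤ r := by
      rw [← dist_eq_norm, dist_comm]; exact (Metric.mem_ball.1 hy1).le
    apply ENNReal.ofReal_le_ofReal
    refine div_le_div₀ (by positivity) (Real.rpow_le_rpow (by positivity) ?_ hp.le)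
      (by positivity) (Real.rpow_le_rpow hxy.le hxyr (by positivity))
    exact le_trans (by linarith) (le_abs_self _)
  refine le_trans (le_of_eq ?_) (mul_le_mul_right hG _)
  rw [← ENNReal.ofReal_mul (by positivity), ← ENNReal.ofReal_mul (by positivity)]
  congr 1
  have hbe : b ^ (p * s / N) = a ^ (p * s / N) * I ^ (p * s / N) / t ^ (P * (p * s / N)) := by
    rw [hb, Real.div_rpow (by positivity) (by positivity), Real.mul_rpow ha0.le hI.le,
      ← Real.rpow_mul ht.le]
  rw [Real.rpow_add hr0, Real.rpow_natCast, hrN, hrps, hbe, Real.div_rpow ht.le (by norm_num),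
    Real.rpow_add (by norm_num : (0 : ℝ) < 2), Real.rpow_one]
  conv_lhs => rw [← hid, Real.rpow_add ht]
  have h1 : (0 : ℝ) < 2 ^ p := by positivity
  have h2 : (0 : ℝ) < t ^ P := by positivity
  have h3 : (0 : ℝ) < a ^ (p * s / N) := by positivity
  have h4 : (0 : ℝ) < I ^ (p * s / N) := by positivity
  field_simp

lemma eLpNorm_ofReal_rpow {μ : Measure (Space N)} {r : ℝ} (hr : 0 < r) :
    eLpNorm u (ENNReal.ofReal r) μ ^ r = ∫⁻ x, ENNReal.ofReal (|u x| ^ r) ∂μ := by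
  rw [eLpNorm_eq_lintegral_rpow_enorm_toReal (by simpa using hr) (by simp),
    ENNReal.toReal_ofReal hr.le, ← ENNReal.rpow_mul, one_div_mul_cancel hr.ne', ENNReal.rpow_one]
  refine lintegral_congr fun x => ?_
  rw [← ENNReal.ofReal_rpow_of_nonneg (abs_nonneg _) hr.le, ← Real.norm_eq_abs, ofReal_norm]

/-- The double integral in `gagliardo`, without the root. -/
lemma gagliardo_rpow (hp : 0 < p) (u : Space N → ℝ) : gagliardo s p u ^ p =
    ∫⁻ z : Space N × Space N,
      ENNReal.ofReal (|u z.1 - u z.2| ^ p / ‖z.1 - z.2‖ ^ ((N : ℝ) + p * s)) := by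
  rw [gagliardo, ← ENNReal.rpow_mul, one_div_mul_cancel hp.ne', ENNReal.rpow_one]

lemma gagliardo_congr {u v : Space N → ℝ} (h : u =ᵐ[volume] v) :
    gagliardo s p u = gagliardo s p v := by
  unfold gagliardo
  congr 1
  apply lintegral_congr_ae
  have h1 := Measure.quasiMeasurePreserving_fst (μ := (volume : Measure (Space N)))
    (ν := (volume : Measure (Space N))) |>.ae_eq_comp h
  have h2 := Measure.quasiMeasurePreserving_snd (μ := (volume : Measure (Space N)))
    (ν := (volume : Measure (Space N))) |>.ae_eq_comp h
  filter_upwards [h1, h2] with z hz1 hz2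
  simp only [Function.comp_apply] at hz1 hz2
  rw [hz1, hz2]

lemma gagliardo_rpow_mono (hp : 0 < p) {u v : Space N → ℝ}
    (h : ∀ x y, |v x - v y| ≤ |u x - u y|) : gagliardo s p v ^ p ≤ gagliardo s p u ^ p := by
  rw [gagliardo_rpow hp, gagliardo_rpow hp]
  apply lintegral_mono
  intro z
  apply ENNReal.ofReal_le_ofReal
  exact div_le_div_of_nonneg_right (Real.rpow_le_rpow (abs_nonneg _) (h _ _) hp.le)
    (by positivity)

/-- The fractional Sobolev inequality for functions that are already known to be in `L^{p*}`. -/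
lemma exists_sobolev_of_finite (hp : 0 < p) (hs : 0 < s) (hps : p * s < N) :
    ∃ C : ℝ, 0 < C ∧ ∀ v : Space N → ℝ, Measurable v → (∀ x, 0 ≤ v x) →
      ∫⁻ x, ENNReal.ofReal (v x ^ critExp N s p) ≠ ∞ →
      (∫⁻ x, ENNReal.ofReal (v x ^ critExp N s p)) ^ (p / critExp N s p) ≤
        ENNReal.ofReal C * gagliardo s p v ^ p := by
  obtain ⟨C, hC, H⟩ := exists_rpow_critExp_le hp hs hps
  refine ⟨C, hC, fun v hv hv0 hfin => ?_⟩
  have hP0 : 0 < critExp N s p := hp.trans (critExp_gt hp hs hps)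
  have hid := critExp_identity hp hs hps
  set P := critExp N s p with hP
  have hps0 : 0 < p * s := mul_pos hp hs
  have hN0 : (0 : ℝ) < N := hps0.trans hps
  rcases eq_or_ne (∫⁻ x, ENNReal.ofReal (v x ^ P)) 0 with h0 | h0
  · rw [h0, ENNReal.zero_rpow_of_pos (by positivity)]; exact zero_le
  set I := (∫⁻ x, ENNReal.ofReal (v x ^ P)).toReal with hI
  have hI0 : 0 < I := ENNReal.toReal_pos h0 hfin
  have hIe : ∫⁻ x, ENNReal.ofReal (v x ^ P) = ENNReal.ofReal I := (ENNReal.ofReal_toReal hfin).symm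
  have key : ∫⁻ x, ENNReal.ofReal (v x ^ P) ≤
      ENNReal.ofReal (C * I ^ (p * s / N)) * gagliardo s p v ^ p := by
    have hmeas : Measurable fun z : Space N × Space N =>
        ENNReal.ofReal (|v z.1 - v z.2| ^ p / ‖z.1 - z.2‖ ^ ((N : ℝ) + p * s)) := by
      fun_prop
    rw [gagliardo_rpow hp, Measure.volume_eq_prod, lintegral_prod _ hmeas.aemeasurable,
      ← lintegral_const_mul _ hmeas.lintegral_prod_right']
    exact lintegral_mono fun x => H v hv hv0 I hI0 hIe.le x
  rw [hIe] at key ⊢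
  have hexp : p / P = 1 - p * s / N := by
    rw [div_eq_iff hP0.ne']; linarith
  have h4 : (0 : ℝ) < I ^ (p * s / N) := by positivity
  rw [ENNReal.ofReal_rpow_of_pos hI0, hexp, Real.rpow_sub hI0, Real.rpow_one,
    ENNReal.ofReal_div_of_pos h4]
  apply ENNReal.div_le_of_le_mul
  rw [mul_right_comm, ← ENNReal.ofReal_mul hC.le]
  exact key

/-- The fractional Sobolev inequality. Truncation at the levels `n = 0, 1, …` makes the `L^{p*}`
norm finite a priori. -/
theorem exists_sobolev (hp : 0 < p) (hs : 0 < s) (hps : p * s < N) :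
    ∃ C : ℝ, 0 < C ∧ ∀ u : Space N → ℝ, MemLp u (ENNReal.ofReal p) volume →
      (∫⁻ x, ENNReal.ofReal (|u x| ^ critExp N s p)) ^ (p / critExp N s p) ≤
        ENNReal.ofReal C * gagliardo s p u ^ p := by
  obtain ⟨C, hC, H⟩ := exists_sobolev_of_finite hp hs hps
  refine ⟨C, hC, ?_⟩
  have hpP := critExp_gt hp hs hps
  set P := critExp N s p with hP
  have hP0 : 0 < P := hp.trans hpP
  -- passage to a measurable representative
  suffices h : ∀ u : Space N → ℝ, Measurable u → MemLp u (ENNReal.ofReal p) volume →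
      (∫⁻ x, ENNReal.ofReal (|u x| ^ P)) ^ (p / P) ≤ ENNReal.ofReal C * gagliardo s p u ^ p by
    intro u hu
    have hae := hu.1.ae_eq_mk
    have := h (hu.1.mk u) hu.1.stronglyMeasurable_mk.measurable (hu.ae_eq hae)
    rw [← gagliardo_congr hae] at this
    refine le_trans (le_of_eq ?_) this
    congr 1
    apply lintegral_congr_ae
    filter_upwards [hae] with x hx
    rw [hx]
  intro u hum hu
  have hLp : ∫⁻ x, ENNReal.ofReal (|u x| ^ p) < ∞ := by
    rw [← eLpNorm_ofReal_rpow hp]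
    exact ENNReal.rpow_lt_top_of_nonneg hp.le hu.2.ne
  have hn : ∀ n : ℕ, (∫⁻ x, ENNReal.ofReal (min |u x| n ^ P)) ^ (p / P) ≤
      ENNReal.ofReal C * gagliardo s p u ^ p := by
    intro n
    refine (H (fun x => min |u x| n) (by fun_prop) (fun x => by positivity) ?_).trans ?_
    · refine ((lintegral_mono (g := fun x => ENNReal.ofReal ((n : ℝ) ^ (P - p)) *
        ENNReal.ofReal (|u x| ^ p)) fun x => ?_).trans_lt ?_).ne
      · beta_reduce
        rw [← ENNReal.ofReal_mul (by positivity)]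
        apply ENNReal.ofReal_le_ofReal
        have h0 : 0 ≤ min |u x| (n : ℝ) := by positivity
        calc min |u x| (n : ℝ) ^ P = min |u x| (n : ℝ) ^ (P - p) * min |u x| (n : ℝ) ^ p := by
              rw [← Real.rpow_add_of_nonneg h0 (by linarith) hp.le]; congr 1; ring
          _ ≤ (n : ℝ) ^ (P - p) * |u x| ^ p := by
              gcongr
              · exact min_le_right _ _
              · exact min_le_left _ _
      · rw [lintegral_const_mul _ (by fun_prop)]
        exact ENNReal.mul_lt_top ENNReal.ofReal_lt_top hLp
    · refine mul_le_mul_right (gagliardo_rpow_mono hp fun x y => ?_) _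
      refine (abs_min_sub_min_le_max _ _ _ _).trans ?_
      simp only [sub_self, abs_zero]
      exact max_le (abs_abs_sub_abs_le _ _) (abs_nonneg _)
  have hn' : ∀ n : ℕ, ∫⁻ x, ENNReal.ofReal (min |u x| n ^ P) ≤
      (ENNReal.ofReal C * gagliardo s p u ^ p) ^ (P / p) := by
    intro n
    have := ENNReal.rpow_le_rpow (hn n) (z := P / p) (by positivity)
    rwa [← ENNReal.rpow_mul, div_mul_div_cancel₀ hP0.ne', div_self hp.ne', ENNReal.rpow_one]
      at this
  have hlim : ∫⁻ x, ENNReal.ofReal (|u x| ^ P) ≤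
      (ENNReal.ofReal C * gagliardo s p u ^ p) ^ (P / p) := by
    refine le_trans ?_ (Filter.liminf_le_of_frequently_le' (f := Filter.atTop)
      (Filter.Frequently.of_forall hn'))
    refine le_trans (lintegral_mono fun x => ?_) (lintegral_liminf_le fun n => by fun_prop)
    refine Filter.le_liminf_of_le (by isBoundedDefault) ?_
    obtain ⟨m, hm⟩ := exists_nat_ge |u x|
    filter_upwards [Filter.eventually_ge_atTop m] with n hmn
    rw [min_eq_left (hm.trans (by exact_mod_cast hmn))]
  have := ENNReal.rpow_le_rpow hlim (z := p / P) (by positivity)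
  rwa [← ENNReal.rpow_mul (_ * _), div_mul_div_cancel₀ hp.ne', div_self hP0.ne', ENNReal.rpow_one]
    at this

/-! ### Testing the equation with truncations -/

lemma continuous_of_abs_sub_le (hT : ∀ a b, |T a - T b| ≤ |a - b|) : Continuous T := by
  have : LipschitzWith 1 T := LipschitzWith.of_dist_le_mul fun a b => by
    simpa [Real.dist_eq] using hT a b
  exact this.continuous

lemma MemW0.comp (hu : MemW0 s p Ω u) (hp : 0 < p) (hT : ∀ a b, |T a - T b| ≤ |a - b|)
    (hT0 : T 0 = 0) : MemW0 s p Ω (fun x => T (u x)) where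
  memLp := by
    refine hu.memLp.mono ((continuous_of_abs_sub_le hT).comp_aestronglyMeasurable hu.memLp.1)
      (.of_forall fun x => ?_)
    simpa [hT0] using hT (u x) 0
  gagliardo_lt_top := by
    have h := (gagliardo_rpow_mono (s := s) hp (u := u) (v := fun x => T (u x))
      fun x y => hT _ _).trans_lt (ENNReal.rpow_lt_top_of_nonneg hp.le hu.gagliardo_lt_top.ne)
    exact (ENNReal.rpow_lt_top_iff_of_pos hp).1 h
  ae_eq_zero := by
    filter_upwards [hu.ae_eq_zero] with x hx
    rw [hx, hT0]

lemma MemW0.neg (hu : MemW0 s p Ω u) (hp : 0 < p) : MemW0 s p Ω (fun x => -u x) :=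
  hu.comp (T := fun t => -t) hp (fun a b => by rw [neg_sub_neg, abs_sub_comm]) neg_zero

lemma pairing_neg_left : pairing s p (fun x => -u x) φ = pairing s p u (fun x => -φ x) := by
  unfold pairing
  congr 1
  ext z
  rw [neg_sub_neg, abs_sub_comm]
  ring

lemma abs_sub_rpow_le_of_monotone (hp : 1 < p) (hm : Monotone T)
    (hT : ∀ a b, |T a - T b| ≤ |a - b|) (a b : ℝ) :
    |T a - T b| ^ p ≤ |a - b| ^ (p - 2) * (a - b) * (T a - T b) := by
  have hprod : (a - b) * (T a - T b) = |a - b| * |T a - T b| := by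
    rw [← abs_mul, abs_of_nonneg]
    rcases le_total a b with h | h
    · exact mul_nonneg_of_nonpos_of_nonpos (sub_nonpos.2 h) (sub_nonpos.2 (hm h))
    · exact mul_nonneg (sub_nonneg.2 h) (sub_nonneg.2 (hm h))
  rw [mul_assoc, hprod, ← mul_assoc]
  rcases (abs_nonneg (T a - T b)).eq_or_lt with h0 | h0
  · rw [← h0, Real.zero_rpow (by linarith)]; simp
  have h1 : 0 < |a - b| := h0.trans_le (hT a b)
  calc |T a - T b| ^ p = |T a - T b| ^ (p - 1) * |T a - T b| := by
        rw [← Real.rpow_add_one h0.ne']; congr 1; ring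
    _ ≤ |a - b| ^ (p - 1) * |T a - T b| := by
        refine mul_le_mul_of_nonneg_right ?_ h0.le
        exact Real.rpow_le_rpow h0.le (hT a b) (by linarith)
    _ = |a - b| ^ (p - 2) * |a - b| * |T a - T b| := by
        rw [← Real.rpow_add_one h1.ne']; congr 2; ring

/-- Testing with `T ∘ u`, for `T` nondecreasing and `1`-Lipschitz, controls the energy
of `T ∘ u`. The integrand of the pairing is dominated by that of `gagliardo s p u ^ p`, so that
the pairing is a genuine integral. -/
lemma MemW0.gagliardo_comp_rpow_le (hu : MemW0 s p Ω u) (hp : 1 < p) (hm : Monotone T)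
    (hT : ∀ a b, |T a - T b| ≤ |a - b|) :
    gagliardo s p (fun x => T (u x)) ^ p ≤
      ENNReal.ofReal (pairing s p u (fun x => T (u x))) := by
  have hp0 : 0 < p := by linarith
  have hTc : Continuous T := continuous_of_abs_sub_le hT
  have hu1 : AEMeasurable (fun z : Space N × Space N => u z.1) :=
    hu.memLp.1.aemeasurable.comp_quasiMeasurePreserving Measure.quasiMeasurePreserving_fst
  have hu2 : AEMeasurable (fun z : Space N × Space N => u z.2) :=
    hu.memLp.1.aemeasurable.comp_quasiMeasurePreserving Measure.quasiMeasurePreserving_snd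
  have hT1 : AEMeasurable (fun z : Space N × Space N => T (u z.1)) :=
    hTc.measurable.comp_aemeasurable hu1
  have hT2 : AEMeasurable (fun z : Space N × Space N => T (u z.2)) :=
    hTc.measurable.comp_aemeasurable hu2
  have hD : AEMeasurable (fun z : Space N × Space N => |u z.1 - u z.2|) :=
    continuous_abs.measurable.comp_aemeasurable (hu1.sub hu2)
  have hK : Measurable fun z : Space N × Space N => ‖z.1 - z.2‖ ^ ((N : ℝ) + p * s) := by
    fun_prop
  have hdom : Integrable (fun z : Space N × Space N =>
      |u z.1 - u z.2| ^ p / ‖z.1 - z.2‖ ^ ((N : ℝ) + p * s)) := by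
    refine ⟨((hD.pow_const p).div hK.aemeasurable).aestronglyMeasurable, ?_⟩
    rw [hasFiniteIntegral_iff_ofReal (.of_forall fun z => by positivity), ← gagliardo_rpow hp0]
    exact ENNReal.rpow_lt_top_of_nonneg hp0.le hu.gagliardo_lt_top.ne
  have hlow := fun z : Space N × Space N =>
    abs_sub_rpow_le_of_monotone hp hm hT (u z.1) (u z.2)
  have hint : Integrable (fun z : Space N × Space N =>
      |u z.1 - u z.2| ^ (p - 2) * (u z.1 - u z.2) * (T (u z.1) - T (u z.2))
        / ‖z.1 - z.2‖ ^ ((N : ℝ) + p * s)) := by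
    refine hdom.mono ((((hD.pow_const (p - 2)).mul (hu1.sub hu2)).mul (hT1.sub hT2)).div
      hK.aemeasurable).aestronglyMeasurable (.of_forall fun z => ?_)
    rw [Real.norm_of_nonneg (div_nonneg ((by positivity : (0 : ℝ) ≤ _).trans (hlow z))
      (by positivity)), Real.norm_of_nonneg (by positivity)]
    refine div_le_div_of_nonneg_right ?_ (by positivity)
    rcases (abs_nonneg (u z.1 - u z.2)).eq_or_lt with h0 | h0
    · rw [abs_eq_zero.1 h0.symm]; simp; positivity
    calc |u z.1 - u z.2| ^ (p - 2) * (u z.1 - u z.2) * (T (u z.1) - T (u z.2))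
        ≤ |u z.1 - u z.2| ^ (p - 2) * (|u z.1 - u z.2| * |u z.1 - u z.2|) := by
          rw [mul_assoc]
          refine mul_le_mul_of_nonneg_left ((le_abs_self _).trans ?_) (by positivity)
          rw [abs_mul]
          exact mul_le_mul_of_nonneg_left (hT _ _) (abs_nonneg _)
      _ = |u z.1 - u z.2| ^ p := by
          rw [← mul_assoc, ← Real.rpow_add_one h0.ne', ← Real.rpow_add_one h0.ne']
          congr 1; ring
  rw [gagliardo_rpow hp0, pairing, ofReal_integral_eq_lintegral_ofReal hint
    (.of_forall fun z => div_nonneg ((by positivity : (0 : ℝ) ≤ _).trans (hlow z))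
      (by positivity))]
  refine lintegral_mono fun z => ENNReal.ofReal_le_ofReal ?_
  exact div_le_div_of_nonneg_right (hlow z) (by positivity)

/-- The only consequence of the equation and of the growth condition that the bounds use: the
pairing with any test function is controlled by the growth of the reaction. Unlike the equation,
it is invariant under `u ↦ -u`. -/
def PairingBound (s p : ℝ) (Ω : Set (Space N)) (q C₀ : ℝ) (u : Space N → ℝ) : Prop :=
  ∀ φ : Space N → ℝ, MemW0 s p Ω φ → ENNReal.ofReal (pairing s p u φ) ≤
    ∫⁻ x in Ω, ENNReal.ofReal (C₀ * (1 + |u x| ^ (q - 1)) * |φ x|)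

lemma IsWeakSolution.pairingBound {q C₀ : ℝ} {f : Space N → ℝ → ℝ}
    (hu : IsWeakSolution s p Ω f u) (hf : GrowthCondition Ω q C₀ f) :
    PairingBound s p Ω q C₀ u := by
  intro φ hφ
  rw [hu.weak φ hφ]
  refine (Real.ofReal_le_enorm _).trans ((enorm_integral_le_lintegral_enorm _).trans ?_)
  apply lintegral_mono_ae
  filter_upwards [hf.growth] with x hx
  rw [← ofReal_norm, norm_mul, Real.norm_eq_abs, Real.norm_eq_abs]
  exact ENNReal.ofReal_le_ofReal (mul_le_mul_of_nonneg_right (hx _) (abs_nonneg _))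

lemma PairingBound.neg {q C₀ : ℝ} (h : PairingBound s p Ω q C₀ u) (hp : 0 < p) :
    PairingBound s p Ω q C₀ (fun x => -u x) := by
  intro φ hφ
  rw [pairing_neg_left]
  simpa using h _ (hφ.neg hp)

/-! ### Level set iteration -/

lemma abs_posPart_sub_le (k a b : ℝ) : |max (a - k) 0 - max (b - k) 0| ≤ |a - b| := by
  refine (abs_max_sub_max_le_max _ _ _ _).trans ?_
  simp

lemma monotone_posPart_sub (k : ℝ) : Monotone fun a : ℝ => max (a - k) 0 := by
  intro a b hab
  exact max_le_max (by linarith) le_rfl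

lemma growth_mul_posPart_le {P q C₀ k₀ h k t : ℝ} (hP : 1 < P) (hq1 : 1 ≤ q) (hqP : q ≤ P)
    (hC₀ : 0 ≤ C₀) (hk₀ : 1 ≤ k₀) (hh : k₀ ≤ h) (hhk : h < k) :
    C₀ * (1 + |t| ^ (q - 1)) * |max (t - k) 0| ≤
      2 * C₀ * k₀ ^ (q - P) * (k / (k - h)) ^ (P - 1) * max (t - h) 0 ^ P := by
  have hkh : 0 < k - h := by linarith
  have hk₀' : 0 < k₀ := by linarith
  have hk : 0 < k := by linarith
  rcases le_or_gt t k with htk | htk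
  · rw [max_eq_right (by linarith : t - k ≤ 0), abs_zero, mul_zero]
    positivity
  have ht : 0 < t := by linarith
  have hth : 0 < t - h := by linarith
  rw [max_eq_left (by linarith : 0 ≤ t - k), max_eq_left hth.le, abs_of_pos ht,
    abs_of_pos (by linarith : 0 < t - k)]
  have h1 : 1 ≤ t ^ (q - 1) := Real.one_le_rpow (by linarith) (by linarith)
  have h2 : t ^ (q - 1) ≤ k₀ ^ (q - P) * t ^ (P - 1) := by
    calc t ^ (q - 1) = t ^ (q - P) * t ^ (P - 1) := by rw [← Real.rpow_add ht]; congr 1; ring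
      _ ≤ k₀ ^ (q - P) * t ^ (P - 1) := by
        gcongr ?_ * _
        exact Real.rpow_le_rpow_of_nonpos (by linarith) (by linarith) (by linarith)
  have h3 : t ≤ k / (k - h) * (t - h) := by
    rw [div_mul_eq_mul_div, le_div_iff₀ hkh]
    nlinarith
  have h4 : t ^ (P - 1) ≤ (k / (k - h)) ^ (P - 1) * (t - h) ^ (P - 1) := by
    rw [← Real.mul_rpow (div_nonneg (by linarith) hkh.le) hth.le]
    exact Real.rpow_le_rpow ht.le h3 (by linarith)
  have hk0 : 0 ≤ k₀ ^ (q - P) := by positivity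
  calc C₀ * (1 + t ^ (q - 1)) * (t - k)
      ≤ C₀ * (2 * (k₀ ^ (q - P) * ((k / (k - h)) ^ (P - 1) * (t - h) ^ (P - 1)))) * (t - h) := by
        refine mul_le_mul (mul_le_mul_of_nonneg_left ?_ hC₀) (by linarith) (by linarith)
          (by positivity)
        linarith [mul_le_mul_of_nonneg_left h4 hk0]
    _ = 2 * C₀ * k₀ ^ (q - P) * (k / (k - h)) ^ (P - 1) * ((t - h) ^ (P - 1) * (t - h)) := by ring
    _ = _ := by
        rw [← Real.rpow_add_one hth.ne']; congr 2; ring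

/-- One step of the level set iteration. On `{u > k}` one has `u ≤ k / (k - h) * (u - h)`, so the
critical power of `u` is controlled by that of `(u - h)₊` and no absorption is needed. -/
lemma levelset_step {P S q C₀ k₀ h k : ℝ} (hp : 1 < p) (hP : 1 < P)
    (hS : ∀ u : Space N → ℝ, MemLp u (ENNReal.ofReal p) volume →
      (∫⁻ x, ENNReal.ofReal (|u x| ^ P)) ^ (p / P) ≤ ENNReal.ofReal S * gagliardo s p u ^ p)
    (hu : MemW0 s p Ω u) (hb : PairingBound s p Ω q C₀ u) (hq1 : 1 ≤ q) (hqP : q ≤ P)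
    (hS0 : 0 ≤ S) (hC₀ : 0 ≤ C₀) (hk₀ : 1 ≤ k₀) (hh : k₀ ≤ h) (hhk : h < k) :
    (∫⁻ x, ENNReal.ofReal (max (u x - k) 0 ^ P)) ^ (p / P) ≤
      ENNReal.ofReal (S * (2 * C₀ * k₀ ^ (q - P) * (k / (k - h)) ^ (P - 1))) *
        ∫⁻ x, ENNReal.ofReal (max (u x - h) 0 ^ P) := by
  have hp0 : 0 < p := by linarith
  have hW : MemW0 s p Ω (fun x => max (u x - k) 0) :=
    hu.comp (T := fun a => max (a - k) 0) hp0 (abs_posPart_sub_le k)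
      (max_eq_right (by linarith))
  have hG := (hu.gagliardo_comp_rpow_le hp (monotone_posPart_sub k)
    (abs_posPart_sub_le k)).trans (hb _ hW)
  have hSob := hS _ hW.memLp
  simp only [abs_of_nonneg (le_max_right _ (0 : ℝ))] at hSob
  rw [ENNReal.ofReal_mul hS0, mul_assoc]
  refine hSob.trans (mul_le_mul_right (hG.trans ?_) _)
  rw [← lintegral_const_mul' _ _ ENNReal.ofReal_ne_top]
  refine (lintegral_mono fun x => ?_).trans (setLIntegral_le_lintegral Ω _)
  have hkh : 0 < k - h := by linarith
  have hk₀' : 0 < k₀ := by linarith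
  have hk : 0 < k := by linarith
  rw [← ENNReal.ofReal_mul (by positivity)]
  exact ENNReal.ofReal_le_ofReal (growth_mul_posPart_le hP hq1 hqP hC₀ hk₀ hh hhk)

/-- Geometric decay for a superlinear recursion with geometrically growing coefficients. -/
lemma le_geometric_of_superlinear {Z : ℕ → ℝ≥0∞} {θ E B ρ δ : ℝ} (hθ0 : 0 < θ) (hE : 0 ≤ E)
    (hB : 0 ≤ B) (hρ : 0 < ρ) (hBρ : B * ρ = ρ ^ θ) (hδ : 0 ≤ δ)
    (hEδ : E * δ ^ (1 - θ) ≤ ρ ^ θ) (h0 : Z 0 ≤ ENNReal.ofReal δ)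
    (hZ : ∀ n, Z (n + 1) ^ θ ≤ ENNReal.ofReal (E * B ^ n) * Z n) (n : ℕ) :
    Z n ≤ ENNReal.ofReal (δ * ρ ^ n) := by
  induction n with
  | zero => simpa using h0
  | succ n ih =>
    rw [← ENNReal.rpow_le_rpow_iff hθ0]
    refine (hZ n).trans ((mul_le_mul_right ih _).trans ?_)
    rw [← ENNReal.ofReal_mul (by positivity), ENNReal.ofReal_rpow_of_nonneg (by positivity) hθ0.le]
    apply ENNReal.ofReal_le_ofReal
    have hEδ' : E * δ ≤ ρ ^ θ * δ ^ θ := by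
      rcases hδ.eq_or_lt with rfl | hδ
      · rw [mul_zero]; positivity
      calc E * δ = E * δ ^ (1 - θ) * δ ^ θ := by
            rw [mul_assoc, ← Real.rpow_add hδ, sub_add_cancel, Real.rpow_one]
        _ ≤ ρ ^ θ * δ ^ θ := by gcongr
    calc E * B ^ n * (δ * ρ ^ n) = E * δ * (B * ρ) ^ n := by rw [mul_pow]; ring
      _ ≤ ρ ^ θ * δ ^ θ * (ρ ^ θ) ^ n := by rw [hBρ]; gcongr
      _ = (δ * ρ ^ (n + 1)) ^ θ := by
        rw [Real.mul_rpow hδ (by positivity), ← Real.rpow_pow_comm hρ.le, pow_succ]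
        ring

/-- The smallness principle behind all the `L^∞` bounds: if the part of `∫ u ^ p*` above the level
`k₀` is small relative to the constant of the growth condition above that level, then
`u ≤ 2 * k₀`. The iteration runs over the levels `k₀ * (2 - 2 ^ (-n))`. -/
theorem exists_smallness_ae_le (hp : 1 < p) (hs : 0 < s) (hps : p * s < N) :
    ∃ c : ℝ, 0 < c ∧ ∀ (Ω : Set (Space N)) (u : Space N → ℝ) (q C₀ k₀ δ : ℝ),
      MemW0 s p Ω u → PairingBound s p Ω q C₀ u → 1 ≤ q → q ≤ critExp N s p → 0 ≤ C₀ →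
      1 ≤ k₀ → 0 ≤ δ → C₀ * k₀ ^ (q - critExp N s p) * δ ^ (1 - p / critExp N s p) ≤ c →
      ∫⁻ x, ENNReal.ofReal (max (u x - k₀) 0 ^ critExp N s p) ≤ ENNReal.ofReal δ →
      ∀ᵐ x, u x ≤ 2 * k₀ := by
  have hp0 : 0 < p := by linarith
  obtain ⟨S, hS0, hS⟩ := exists_sobolev hp0 hs hps
  have hpP := critExp_gt hp0 hs hps
  set P := critExp N s p with hPdef
  have hP0 : 0 < P := by linarith
  set θ := p / P with hθ
  have hθ0 : 0 < θ := by positivity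
  have hθ1 : θ < 1 := (div_lt_one hP0).2 hpP
  set B : ℝ := 2 ^ (P - 1) with hB
  have hB1 : 1 < B := Real.one_lt_rpow (by norm_num) (by linarith)
  -- the decay rate at which the factor `B ^ n` cancels: `B * ρ = ρ ^ θ`
  set ρ : ℝ := B ^ (-(1 / (1 - θ))) with hρ
  have hρ0 : 0 < ρ := by positivity
  have hρ1 : ρ < 1 := Real.rpow_lt_one_of_one_lt_of_neg hB1
    (neg_neg_of_pos (one_div_pos.2 (by linarith)))
  have hBρ : B * ρ = ρ ^ θ := by
    have hB0 : 0 < B := by positivity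
    rw [hρ, ← Real.rpow_mul hB0.le, mul_comm, ← Real.rpow_add_one hB0.ne']
    congr 1
    have : 1 - θ ≠ 0 := by linarith
    field_simp
    ring
  refine ⟨ρ ^ θ / (2 * S * B ^ 2), by positivity, ?_⟩
  intro Ω u q C₀ k₀ δ hu hb hq1 hqP hC₀ hk₀ hδ hsmall hinit
  set k : ℕ → ℝ := fun n => k₀ * (2 - (1 / 2) ^ n) with hk
  set Z : ℕ → ℝ≥0∞ := fun n => ∫⁻ x, ENNReal.ofReal (max (u x - k n) 0 ^ P) with hZ
  set E : ℝ := 2 * S * B ^ 2 * (C₀ * k₀ ^ (q - P)) with hE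
  have hstep : ∀ n, Z (n + 1) ^ θ ≤ ENNReal.ofReal (E * B ^ n) * Z n := by
    intro n
    have hpow : (0 : ℝ) < (1 / 2) ^ n := by positivity
    have hpow1 : (1 / 2 : ℝ) ^ n ≤ 1 := pow_le_one₀ (by norm_num) (by norm_num)
    have hdiff : k (n + 1) - k n = k₀ * (1 / 2) ^ (n + 1) := by
      simp only [hk, pow_succ]; ring
    have hkn : k₀ ≤ k n := by simp only [hk]; nlinarith
    have hlt : k n < k (n + 1) := by
      rw [← sub_pos, hdiff]; positivity
    have hle : k (n + 1) ≤ 2 * k₀ := by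
      have : (0 : ℝ) < (1 / 2) ^ (n + 1) := by positivity
      simp only [hk]; nlinarith
    refine (levelset_step hp (by linarith) hS hu hb hq1 hqP hS0.le hC₀ hk₀ hkn hlt).trans ?_
    refine mul_le_mul_left (ENNReal.ofReal_le_ofReal ?_) _
    have hratio : k (n + 1) / (k (n + 1) - k n) ≤ 2 ^ (n + 2) := by
      rw [hdiff, div_le_iff₀ (by positivity)]
      refine hle.trans (le_of_eq ?_)
      rw [one_div, inv_pow, pow_succ 2 (n + 1)]
      field_simp
    have hratio' : (k (n + 1) / (k (n + 1) - k n)) ^ (P - 1) ≤ B ^ (n + 2) := by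
      rw [hB, Real.rpow_pow_comm (by norm_num)]
      refine Real.rpow_le_rpow (div_nonneg ?_ (by linarith)) hratio (by linarith)
      linarith
    calc S * (2 * C₀ * k₀ ^ (q - P) * (k (n + 1) / (k (n + 1) - k n)) ^ (P - 1))
        ≤ S * (2 * C₀ * k₀ ^ (q - P) * B ^ (n + 2)) := by gcongr
      _ = E * B ^ n := by rw [hE, pow_add]; ring
  have hdecay := le_geometric_of_superlinear (Z := Z) hθ0 (by positivity) (by linarith) hρ0 hBρ hδ
    (by
      rw [le_div_iff₀ (by positivity)] at hsmall
      rw [hE]; linarith) (by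
      have hk0 : k 0 = k₀ := by simp only [hk, pow_zero]; ring
      simpa only [hZ, hk0] using hinit) hstep
  have hzero : ∫⁻ x, ENNReal.ofReal (max (u x - 2 * k₀) 0 ^ P) = 0 := by
    have hlim : Filter.Tendsto (fun n : ℕ => ENNReal.ofReal (δ * ρ ^ n)) Filter.atTop (nhds 0) := by
      have := (tendsto_pow_atTop_nhds_zero_of_lt_one hρ0.le hρ1).const_mul δ
      rw [mul_zero] at this
      simpa using ENNReal.tendsto_ofReal this
    refine le_antisymm (ge_of_tendsto' hlim fun n => le_trans ?_ (hdecay n)) zero_le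
    refine lintegral_mono fun x => ENNReal.ofReal_le_ofReal ?_
    refine Real.rpow_le_rpow (le_max_right _ _) (max_le_max ?_ le_rfl) hP0.le
    have : (0 : ℝ) < (1 / 2) ^ n := by positivity
    simp only [hk]; nlinarith
  have hum := hu.memLp.1.aemeasurable
  rw [lintegral_eq_zero_iff' (by fun_prop)] at hzero
  filter_upwards [hzero] with x hx
  by_contra hcon
  have : 0 < max (u x - 2 * k₀) 0 ^ P :=
    Real.rpow_pos_of_pos (lt_max_of_lt_left (by linarith [not_le.1 hcon])) _
  simp only [Pi.zero_apply, ENNReal.ofReal_eq_zero] at hx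
  linarith

/-! ### Bounds for `|u|` -/

lemma exists_one_le_mul_rpow_le (a : ℝ) {b c : ℝ} (hb : b < 0) (hc : 0 < c) :
    ∃ k : ℝ, 1 ≤ k ∧ a * k ^ b ≤ c := by
  have h := (tendsto_rpow_neg_atTop (neg_pos.2 hb)).const_mul a
  rw [neg_neg, mul_zero] at h
  obtain ⟨k, hk, hk1⟩ := ((h.eventually (ge_mem_nhds hc)).and
    (Filter.eventually_ge_atTop 1)).exists
  exact ⟨k, hk1, hk⟩

lemma MemW0.ae_not_mem_imp (hu : MemW0 s p Ω u) (hΩ : IsOpen Ω) :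
    ∀ᵐ x, x ∉ Ω → u x = 0 :=
  (ae_restrict_iff' hΩ.measurableSet.compl).1 hu.ae_eq_zero

lemma normOn_top_le {C : ℝ} (h : ∀ᵐ x, |u x| ≤ C) : normOn Ω ∞ u ≤ ENNReal.ofReal C := by
  rw [normOn, eLpNorm_exponent_top]
  exact eLpNormEssSup_le_of_ae_bound (ae_restrict_of_ae h)

/-- The smallness principle for `|u|`, from its one-sided version for `u` and `-u`. -/
theorem exists_smallness_abs_ae_le (hp : 1 < p) (hs : 0 < s) (hps : p * s < N) :
    ∃ c : ℝ, 0 < c ∧ ∀ (Ω : Set (Space N)) (u : Space N → ℝ) (q C₀ k₀ δ : ℝ), IsOpen Ω →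
      MemW0 s p Ω u → PairingBound s p Ω q C₀ u → 1 ≤ q → q ≤ critExp N s p → 0 ≤ C₀ →
      1 ≤ k₀ → 0 ≤ δ → C₀ * k₀ ^ (q - critExp N s p) * δ ^ (1 - p / critExp N s p) ≤ c →
      ∫⁻ x in {x | x ∈ Ω ∧ k₀ ≤ |u x|}, ENNReal.ofReal (|u x| ^ critExp N s p) ≤
        ENNReal.ofReal δ →
      ∀ᵐ x, |u x| ≤ 2 * k₀ := by
  obtain ⟨c, hc, H⟩ := exists_smallness_ae_le hp hs hps
  refine ⟨c, hc, ?_⟩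
  intro Ω u q C₀ k₀ δ hΩ hu hb hq1 hqP hC₀ hk₀ hδ hsmall hint
  have hp0 : 0 < p := by linarith
  have hP0 : 0 < critExp N s p := hp0.trans (critExp_gt hp0 hs hps)
  have aux : ∀ v : Space N → ℝ, (∀ x, v x ≤ |u x|) →
      ∫⁻ x, ENNReal.ofReal (max (v x - k₀) 0 ^ critExp N s p) ≤ ENNReal.ofReal δ := by
    intro v hv
    refine le_trans ?_ ((lintegral_indicator_le _ _).trans hint)
    apply lintegral_mono_ae
    filter_upwards [hu.ae_not_mem_imp hΩ] with x hx
    by_cases hmem : x ∈ {x | x ∈ Ω ∧ k₀ ≤ |u x|}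
    · rw [Set.indicator_of_mem hmem]
      refine ENNReal.ofReal_le_ofReal (Real.rpow_le_rpow (le_max_right _ _) ?_ hP0.le)
      exact max_le (by linarith [hv x]) (abs_nonneg _)
    · have hle : v x - k₀ ≤ 0 := by
        by_cases hxΩ : x ∈ Ω
        · have : ¬ k₀ ≤ |u x| := fun h => hmem ⟨hxΩ, h⟩
          linarith [hv x, not_le.1 this]
        · have := hv x
          rw [hx hxΩ, abs_zero] at this
          linarith
      rw [max_eq_right hle, Real.zero_rpow hP0.ne', ENNReal.ofReal_zero]
      exact zero_le
  have h1 := H Ω u q C₀ k₀ δ hu hb hq1 hqP hC₀ hk₀ hδ hsmall (aux u fun x => le_abs_self _)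
  have h2 := H Ω (fun x => -u x) q C₀ k₀ δ (hu.neg hp0) (hb.neg hp0) hq1 hqP hC₀ hk₀ hδ hsmall
    (aux _ fun x => neg_le_abs _)
  filter_upwards [h1, h2] with x hx1 hx2
  exact abs_le.2 ⟨by linarith, hx1⟩

/-- Critical growth: the threshold depends neither on the solution nor on the level, and it works
for every growth exponent up to the critical one. -/
theorem exists_critical_threshold (hp : 1 < p) (hs : 0 < s) (hps : p * s < N) {C₀ : ℝ}
    (hC₀ : 0 < C₀) :
    ∃ ε₀ : ℝ, 0 < ε₀ ∧ ∀ (Ω : Set (Space N)) (u : Space N → ℝ) (q K : ℝ), IsOpen Ω →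
      MemW0 s p Ω u → PairingBound s p Ω q C₀ u → 1 ≤ q → q ≤ critExp N s p →
      ∫⁻ x in {x | x ∈ Ω ∧ K ≤ |u x|}, ENNReal.ofReal (|u x| ^ critExp N s p) ≤
        ENNReal.ofReal ε₀ →
      ∀ᵐ x, |u x| ≤ 2 * max K 1 := by
  obtain ⟨c, hc, H⟩ := exists_smallness_abs_ae_le hp hs hps
  have hp0 : 0 < p := by linarith
  have hpP := critExp_gt hp0 hs hps
  set P := critExp N s p with hPdef
  have hP0 : 0 < P := by linarith
  have hexp : 0 < 1 - p / P := sub_pos.2 ((div_lt_one hP0).2 hpP)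
  refine ⟨(c / C₀) ^ (1 / (1 - p / P)), by positivity, ?_⟩
  intro Ω u q K hΩ hu hb hq1 hqP hint
  refine H Ω u q C₀ (max K 1) _ hΩ hu hb hq1 hqP hC₀.le (le_max_right _ _) (by positivity) ?_
    (le_trans (lintegral_mono_set (t := {x | x ∈ Ω ∧ K ≤ |u x|}) fun x hx =>
      ⟨hx.1, (le_max_left _ _).trans hx.2⟩) hint)
  rw [← Real.rpow_mul (by positivity), one_div_mul_cancel hexp.ne', Real.rpow_one]
  have : max K 1 ^ (q - P) ≤ 1 :=
    Real.rpow_le_one_of_one_le_of_nonpos (le_max_right _ _) (by linarith)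
  calc C₀ * max K 1 ^ (q - P) * (c / C₀) ≤ C₀ * 1 * (c / C₀) := by gcongr
    _ = c := by field_simp

/-- Subcritical growth: raising the level makes the constant of the growth condition, relative to
the critical power, as small as the bound on the critical norm requires. -/
theorem exists_bound_of_subcritical (hp : 1 < p) (hs : 0 < s) (hps : p * s < N)
    (C₀ : ℝ) (hC₀ : 0 ≤ C₀) {q : ℝ} (hq1 : 1 ≤ q) (hqP : q < critExp N s p) (M : ℝ) :
    ∃ C : ℝ, 0 < C ∧ ∀ (Ω : Set (Space N)) (u : Space N → ℝ), IsOpen Ω →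
      MemW0 s p Ω u → PairingBound s p Ω q C₀ u →
      normOn Ω (ENNReal.ofReal (critExp N s p)) u ≤ ENNReal.ofReal M →
      normOn Ω ∞ u ≤ ENNReal.ofReal C := by
  obtain ⟨c, hc, H⟩ := exists_smallness_abs_ae_le hp hs hps
  have hP0 : 0 < critExp N s p := by linarith
  set P := critExp N s p with hPdef
  obtain ⟨k₀, hk₀, hk⟩ := exists_one_le_mul_rpow_le (C₀ * (max M 0 ^ P) ^ (1 - p / P))
    (sub_neg.2 hqP) hc
  refine ⟨2 * k₀, by linarith, fun Ω u hΩ hu hb hM => normOn_top_le ?_⟩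
  refine H Ω u q C₀ k₀ (max M 0 ^ P) hΩ hu hb hq1 hqP.le hC₀ hk₀ (by positivity)
    (by linarith) ?_
  refine (lintegral_mono_set fun x hx => hx.1).trans ?_
  rw [← eLpNorm_ofReal_rpow hP0, ← ENNReal.ofReal_rpow_of_nonneg (le_max_right _ _) hP0.le]
  exact ENNReal.rpow_le_rpow (hM.trans (ENNReal.ofReal_le_ofReal (le_max_left _ _))) hP0.le

/-- Qualitative boundedness up to the critical exponent. By the Sobolev inequality `∫ |u| ^ p*` is
finite, so its part above a large level is below the threshold. -/
lemma exists_abs_ae_le (hp : 1 < p) (hs : 0 < s) (hps : p * s < N) {C₀ q : ℝ}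
    (hC₀ : 0 < C₀) (hq1 : 1 ≤ q) (hqP : q ≤ critExp N s p) (hΩ : IsOpen Ω)
    (hu : MemW0 s p Ω u) (hb : PairingBound s p Ω q C₀ u) : ∃ C : ℝ, ∀ᵐ x, |u x| ≤ C := by
  obtain ⟨ε₀, hε₀, H⟩ := exists_critical_threshold hp hs hps hC₀
  have hp0 : 0 < p := by linarith
  obtain ⟨S, hS0, hS⟩ := exists_sobolev hp0 hs hps
  have hP0 : 0 < critExp N s p := hp0.trans (critExp_gt hp0 hs hps)
  set P := critExp N s p with hPdef
  have hfin : ∫⁻ x, ENNReal.ofReal (|u x| ^ P) ≠ ∞ := by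
    have h1 : (∫⁻ x, ENNReal.ofReal (|u x| ^ P)) ^ (p / P) < ∞ :=
      (hS u hu.memLp).trans_lt (ENNReal.mul_lt_top ENNReal.ofReal_lt_top
        (ENNReal.rpow_lt_top_of_nonneg hp0.le hu.gagliardo_lt_top.ne))
    exact ((ENNReal.rpow_lt_top_iff_of_pos (by positivity)).1 h1).ne
  have hum := hu.memLp.1.aemeasurable
  have hgm : AEMeasurable fun x => ENNReal.ofReal (|u x| ^ P) :=
    ((continuous_abs.measurable.comp_aemeasurable hum).pow_const P).ennreal_ofReal
  have hmeas : Filter.Tendsto (volume ∘ fun n : ℕ => {x | x ∈ Ω ∧ (n : ℝ) ≤ |u x|})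
      Filter.atTop (nhds 0) := by
    have hlim : Filter.Tendsto (fun n : ℕ => (∫⁻ x, ENNReal.ofReal (|u x| ^ P)) /
        ENNReal.ofReal ((n : ℝ) ^ P)) Filter.atTop (nhds 0) := by
      have h := ENNReal.Tendsto.const_div (ENNReal.tendsto_ofReal_atTop.comp
        ((tendsto_rpow_atTop hP0).comp tendsto_natCast_atTop_atTop)) (Or.inr hfin)
      rwa [ENNReal.div_top] at h
    refine tendsto_of_tendsto_of_tendsto_of_le_of_le' tendsto_const_nhds hlim
      (.of_forall fun _ => zero_le) ?_
    filter_upwards [Filter.eventually_gt_atTop 0] with n hn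
    have hn' : (0 : ℝ) < n := by exact_mod_cast hn
    refine le_trans (measure_mono fun x hx => ?_) (meas_ge_le_lintegral_div hgm
      (ENNReal.ofReal_pos.2 (Real.rpow_pos_of_pos hn' P)).ne' ENNReal.ofReal_ne_top)
    exact ENNReal.ofReal_le_ofReal (Real.rpow_le_rpow hn'.le hx.2 hP0.le)
  obtain ⟨n, hn⟩ := ((tendsto_setLIntegral_zero hfin hmeas).eventually
    (ge_mem_nhds (ENNReal.ofReal_pos.2 hε₀))).exists
  exact ⟨_, H Ω u q n hΩ hu hb hq1 hqP hn⟩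

/-! ### A priori bound for growth below `p - 1` -/

/-- Young's inequality in the form needed here: since `q < p`, the growth term tested with `u` is
a small multiple of `|u| ^ p` beyond some level `R`, and bounded below it. -/
lemma exists_growth_mul_le {q C₀ η : ℝ} (hq1 : 1 ≤ q) (hqp : q < p) (hC₀ : 0 ≤ C₀) (hη : 0 < η) :
    ∃ A : ℝ, 0 ≤ A ∧ ∀ t : ℝ, 0 ≤ t → C₀ * (1 + t ^ (q - 1)) * t ≤ η * t ^ p + A := by
  obtain ⟨R, hR1, hR⟩ := exists_one_le_mul_rpow_le (2 * C₀) (sub_neg.2 hqp) hη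
  have hR0 : 0 < R := by linarith
  refine ⟨C₀ * (1 + R ^ (q - 1)) * R, by positivity, fun t ht => ?_⟩
  rcases le_total t R with htR | htR
  · have h1 : C₀ * (1 + t ^ (q - 1)) * t ≤ C₀ * (1 + R ^ (q - 1)) * R := by
      gcongr
    have h2 : 0 ≤ η * t ^ p := by positivity
    linarith
  · have ht0 : 0 < t := by linarith
    have h1 : 1 ≤ t ^ (q - 1) := Real.one_le_rpow (by linarith) (by linarith)
    have h2 : t ^ (q - p) ≤ R ^ (q - p) :=
      Real.rpow_le_rpow_of_nonpos hR0 htR (by linarith)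
    have h3 : 0 ≤ C₀ * (1 + R ^ (q - 1)) * R := by positivity
    have h4 : t ^ (q - 1) * t = t ^ (q - p) * t ^ p := by
      rw [← Real.rpow_add_one ht0.ne', ← Real.rpow_add ht0]; congr 1; ring
    have h5 : C₀ * (1 + t ^ (q - 1)) * t ≤ η * t ^ p := by
      calc C₀ * (1 + t ^ (q - 1)) * t ≤ C₀ * (t ^ (q - 1) + t ^ (q - 1)) * t := by gcongr
        _ = 2 * C₀ * t ^ (q - p) * t ^ p := by linear_combination 2 * C₀ * h4
        _ ≤ 2 * C₀ * R ^ (q - p) * t ^ p := by gcongr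
        _ ≤ η * t ^ p := by gcongr
    linarith

lemma normOn_critExp_rpow_le {S : ℝ} (hp : 0 < p) (hP : 0 < critExp N s p)
    (hS : (∫⁻ x, ENNReal.ofReal (|u x| ^ critExp N s p)) ^ (p / critExp N s p) ≤
        ENNReal.ofReal S * gagliardo s p u ^ p) :
    normOn Ω (ENNReal.ofReal (critExp N s p)) u ^ p ≤
      ENNReal.ofReal S * gagliardo s p u ^ p := by
  refine le_trans ?_ hS
  have h : ∀ x : ℝ≥0∞, x ^ p = (x ^ critExp N s p) ^ (p / critExp N s p) := fun x => by
    rw [← ENNReal.rpow_mul, mul_div_cancel₀ _ hP.ne']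
  rw [h, normOn, eLpNorm_ofReal_rpow hP]
  exact ENNReal.rpow_le_rpow (setLIntegral_le_lintegral Ω _) (by positivity)

/-- Growth below `p - 1`: testing with `u` itself, the Sobolev and Hölder inequalities turn the
right-hand side into a small multiple of the energy plus a constant. -/
theorem exists_gagliardo_bound (hp : 1 < p) (hs : 0 < s) (hps : p * s < N)
    (Ω : Set (Space N)) (hΩ : volume Ω < ∞)
    {C₀ q : ℝ} (hC₀ : 0 ≤ C₀) (hq1 : 1 ≤ q) (hqp : q < p) :
    ∃ C : ℝ, 0 < C ∧ ∀ u : Space N → ℝ, MemW0 s p Ω u → PairingBound s p Ω q C₀ u →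
      gagliardo s p u ≤ ENNReal.ofReal C ∧
      normOn Ω (ENNReal.ofReal (critExp N s p)) u ≤ ENNReal.ofReal C := by
  have hp0 : 0 < p := by linarith
  obtain ⟨S, hS0, hS⟩ := exists_sobolev hp0 hs hps
  have hpP := critExp_gt hp0 hs hps
  have hP0 : 0 < critExp N s p := by linarith
  have hSob := fun (u : Space N → ℝ) (hu : MemLp u (ENNReal.ofReal p) volume) =>
    normOn_critExp_rpow_le (Ω := Ω) hp0 hP0 (hS u hu)
  set P := critExp N s p with hPdef
  set V := (volume Ω).toReal with hV
  have hVe : volume Ω = ENNReal.ofReal V := (ENNReal.ofReal_toReal hΩ.ne).symm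
  have hV0 : 0 ≤ V := ENNReal.toReal_nonneg
  have hexp : 0 ≤ 1 / p - 1 / P := sub_nonneg.2 (one_div_le_one_div_of_le hp0 hpP.le)
  -- the Poincaré constant
  set κ : ℝ := S * (V ^ (1 / p - 1 / P)) ^ p with hκ
  have hκ0 : 0 ≤ κ := by positivity
  obtain ⟨A, hA0, hA⟩ := exists_growth_mul_le (η := 1 / (2 * (κ + 1))) hq1 hqp hC₀ (by positivity)
  set D : ℝ := 2 * (A * V) with hD
  have hD0 : 0 ≤ D := by positivity
  refine ⟨((1 + S) * D + 1) ^ (1 / p), by positivity, fun u hu hb => ?_⟩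
  have hpoin : ∫⁻ x in Ω, ENNReal.ofReal (|u x| ^ p) ≤
      ENNReal.ofReal κ * gagliardo s p u ^ p := by
    rw [← eLpNorm_ofReal_rpow hp0]
    have h := eLpNorm_le_eLpNorm_mul_rpow_measure_univ (μ := volume.restrict Ω)
      (ENNReal.ofReal_le_ofReal hpP.le) hu.memLp.1.restrict
    rw [ENNReal.toReal_ofReal hp0.le, ENNReal.toReal_ofReal hP0.le, Measure.restrict_apply_univ,
      hVe, ENNReal.ofReal_rpow_of_nonneg hV0 hexp] at h
    refine (ENNReal.rpow_le_rpow h hp0.le).trans ?_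
    rw [ENNReal.mul_rpow_of_nonneg _ _ hp0.le,
      ENNReal.ofReal_rpow_of_nonneg (by positivity) hp0.le, hκ, ENNReal.ofReal_mul hS0.le,
      mul_right_comm]
    exact mul_le_mul_left (hSob u hu.memLp) _
  have hen : gagliardo s p u ^ p ≤ ENNReal.ofReal (1 / (2 * (κ + 1))) *
      (ENNReal.ofReal κ * gagliardo s p u ^ p) + ENNReal.ofReal A * ENNReal.ofReal V := by
    refine (hu.gagliardo_comp_rpow_le (T := fun t => t) hp monotone_id fun a b => le_rfl).trans
      ((hb _ hu).trans ?_)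
    refine le_trans (lintegral_mono (g := fun x => ENNReal.ofReal (1 / (2 * (κ + 1))) *
      ENNReal.ofReal (|u x| ^ p) + ENNReal.ofReal A) fun x => ?_) ?_
    · beta_reduce
      rw [← ENNReal.ofReal_mul (by positivity), ← ENNReal.ofReal_add (by positivity) hA0]
      exact ENNReal.ofReal_le_ofReal (hA _ (abs_nonneg _))
    · rw [lintegral_add_right _ measurable_const, lintegral_const_mul' _ _ ENNReal.ofReal_ne_top,
        setLIntegral_const, hVe]
      gcongr
  have hXfin : gagliardo s p u ^ p ≠ ∞ :=
    ENNReal.rpow_ne_top_of_nonneg hp0.le hu.gagliardo_lt_top.ne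
  have hX : gagliardo s p u ^ p ≤ ENNReal.ofReal D := by
    set X := (gagliardo s p u ^ p).toReal with hXdef
    have hX0 : 0 ≤ X := ENNReal.toReal_nonneg
    rw [← ENNReal.ofReal_toReal hXfin, ← hXdef, ← ENNReal.ofReal_mul hκ0,
      ← ENNReal.ofReal_mul (by positivity), ← ENNReal.ofReal_mul hA0,
      ← ENNReal.ofReal_add (by positivity) (by positivity),
      ENNReal.ofReal_le_ofReal_iff (by positivity)] at hen
    rw [← ENNReal.ofReal_toReal hXfin, ← hXdef]
    refine ENNReal.ofReal_le_ofReal ?_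
    have h1 : 1 / (2 * (κ + 1)) * (κ * X) ≤ X / 2 := by
      rw [div_mul_eq_mul_div, div_le_div_iff₀ (by positivity) (by norm_num)]
      nlinarith
    rw [hD]; linarith
  have root : ∀ {y : ℝ≥0∞} {b : ℝ}, y ^ p ≤ ENNReal.ofReal b → b ≤ (1 + S) * D + 1 →
      y ≤ ENNReal.ofReal (((1 + S) * D + 1) ^ (1 / p)) := by
    intro y b hy hb
    rw [← ENNReal.rpow_le_rpow_iff hp0, ENNReal.ofReal_rpow_of_nonneg (by positivity) hp0.le,
      ← Real.rpow_mul (by positivity), one_div_mul_cancel hp0.ne', Real.rpow_one]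
    exact hy.trans (ENNReal.ofReal_le_ofReal hb)
  have hSD : 0 ≤ S * D := by positivity
  refine ⟨root hX (by linarith), root (b := S * D) ?_ (by linarith)⟩
  rw [ENNReal.ofReal_mul hS0.le]
  exact (hSob u hu.memLp).trans (mul_le_mul_right hX _)

end FracPLap
theorem proposition2p2 (N : ℕ) (hN : 2 ≤ N) (Ω : Set (FracPLap.Space N))
    (hΩ : FracPLap.IsBoundedC11Domain Ω) (p s : ℝ) (hp : 1 < p) (hs0 : 0 < s) (hs1 : s < 1)
    (hps : p * s < (N : ℝ)) (C₀ : ℝ) (hC₀ : 0 < C₀) :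
    -- every weak solution is bounded
    (∀ q : ℝ, 1 ≤ q → q ≤ FracPLap.critExp N s p →
      ∀ (f : FracPLap.Space N → ℝ → ℝ) (u : FracPLap.Space N → ℝ),
        FracPLap.GrowthCondition Ω q C₀ f → FracPLap.IsWeakSolution s p Ω f u →
          MemLp u ∞ (volume.restrict Ω)) ∧
    -- critical growth
    (∃ ε₀ : ℝ, 0 < ε₀ ∧ ∀ K : ℝ, 0 < K → ∀ M : ℝ, ∃ C : ℝ, 0 < C ∧
      ∀ (f : FracPLap.Space N → ℝ → ℝ) (u : FracPLap.Space N → ℝ),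
        FracPLap.GrowthCondition Ω (FracPLap.critExp N s p) C₀ f →
        FracPLap.IsWeakSolution s p Ω f u →
        FracPLap.normOn Ω (ENNReal.ofReal (FracPLap.critExp N s p)) u ≤ ENNReal.ofReal M →
        (∫⁻ x in {x | x ∈ Ω ∧ K ≤ |u x|}, ENNReal.ofReal (|u x| ^ FracPLap.critExp N s p))
          ≤ ENNReal.ofReal ε₀ →
          FracPLap.normOn Ω ∞ u ≤ ENNReal.ofReal C) ∧
    -- subcritical growth
    (∀ q : ℝ, 1 ≤ q → q < FracPLap.critExp N s p → ∀ M : ℝ, ∃ C : ℝ, 0 < C ∧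
      ∀ (f : FracPLap.Space N → ℝ → ℝ) (u : FracPLap.Space N → ℝ),
        FracPLap.GrowthCondition Ω q C₀ f → FracPLap.IsWeakSolution s p Ω f u →
        FracPLap.normOn Ω (ENNReal.ofReal (FracPLap.critExp N s p)) u ≤ ENNReal.ofReal M →
          FracPLap.normOn Ω ∞ u ≤ ENNReal.ofReal C) ∧
    -- growth exponent below `p`
    (∀ q : ℝ, 1 ≤ q → q < p → ∃ C : ℝ, 0 < C ∧
      ∀ (f : FracPLap.Space N → ℝ → ℝ) (u : FracPLap.Space N → ℝ),
        FracPLap.GrowthCondition Ω q C₀ f → FracPLap.IsWeakSolution s p Ω f u →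
          FracPLap.gagliardo s p u ≤ ENNReal.ofReal C ∧
          FracPLap.normOn Ω ∞ u ≤ ENNReal.ofReal C) := by

  have hp0 : 0 < p := by linarith
  have hpP := FracPLap.critExp_gt hp0 hs0 hps
  have hvol : volume Ω < ∞ := hΩ.isBounded.measure_lt_top
  refine ⟨?_, ?_, ?_, ?_⟩
  · intro q hq1 hqP f u hf hu
    obtain ⟨C, hC⟩ := FracPLap.exists_abs_ae_le hp hs0 hps hC₀ hq1 hqP hΩ.isOpen hu.memW0
      (hu.pairingBound hf)
    exact ⟨hu.memW0.memLp.1.restrict, (FracPLap.normOn_top_le hC).trans_lt ENNReal.ofReal_lt_top⟩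
  · obtain ⟨ε₀, hε₀, H⟩ := FracPLap.exists_critical_threshold hp hs0 hps hC₀
    refine ⟨ε₀, hε₀, fun K hK M => ⟨2 * max K 1, by positivity, fun f u hf hu _ hint => ?_⟩⟩
    exact FracPLap.normOn_top_le (H Ω u _ K hΩ.isOpen hu.memW0 (hu.pairingBound hf)
      (by linarith) le_rfl hint)
  · intro q hq1 hqP M
    obtain ⟨C, hC, H⟩ := FracPLap.exists_bound_of_subcritical hp hs0 hps C₀ hC₀.le hq1 hqP M
    exact ⟨C, hC, fun f u hf hu hM => H Ω u hΩ.isOpen hu.memW0 (hu.pairingBound hf) hM⟩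
  · intro q hq1 hqp
    obtain ⟨C₁, hC₁, H₁⟩ := FracPLap.exists_gagliardo_bound hp hs0 hps Ω hvol hC₀.le hq1 hqp
    obtain ⟨C₂, hC₂, H₂⟩ := FracPLap.exists_bound_of_subcritical hp hs0 hps C₀ hC₀.le hq1
      (hqp.trans hpP) C₁
    refine ⟨max C₁ C₂, lt_max_of_lt_left hC₁, fun f u hf hu => ?_⟩
    have hb := hu.pairingBound hf
    obtain ⟨h1, h2⟩ := H₁ u hu.memW0 hb
    exact ⟨h1.trans (ENNReal.ofReal_le_ofReal (le_max_left _ _)),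
      (H₂ Ω u hΩ.isOpen hu.memW0 hb h2).trans (ENNReal.ofReal_le_ofReal (le_max_right _ _))⟩
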